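/- Let $\lambda=(\lambda_n)_{n\ge 1}$ be a frequency, i.e. a strictly increasing sequence of non-negative real numbers tending to $+\infty$. Let $\mathcal{D}_\infty^{ext}(\lambda)$ be the space of all $\lambda$-Dirichlet series $D=\sum_n a_n e^{-\lambda_n s}$ with complex coefficients that converge at some point $s\in\mathbf{C}$ and whose limit function has a holomorphic and bounded extension $f$ to $[\mathrm{Re}>0]$, and put $\|D\|_\infty:=\sup_{\mathrm{Re}\, s>0}|f(s)|$. For $N\in\mathbf{N}$ let $S_N D:=\sum_{n=1}^N a_n e^{-\lambda_n s}$ be the $N$-th partial sum operator on $\mathcal{D}_\infty^{ext}(\lambda)$ and $$\|S_N\|:=\sup\Big\{\sup_{\mathrm{Re}\, s>0}\Big|\sum_{n=1}^N a_n e^{-\lambda_n s}\Big| : D=\sum_n a_n e^{-\lambda_n s}\in\mathcal{D}_\infty^{ext}(\lambda),\ \|D\|_\infty\le 1\Big\}.$$ Let $d>0$ and assume that there is $l>0$ such that for every $\delta>0$ there is $C'>0$ with $$\lambda_{n+1}-\lambda_n\ \ge\ C' e^{-(l+\delta)\lambda_n^d}\qquad\text{for all } n\in\mathbf{N}.$$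 Then there is a constant $C=C(d,\lambda)>0$ such that for all $N\ge 2$ we have $\|S_N\|\le C\lambda_N^d$, and for all $D=\sum_n a_n e^{-\lambda_n s}\in\mathcal{D}_\infty^{ext}(\lambda)$ $$\sup_{\mathrm{Re}\, s>0}\Big|\sum_{n=1}^N a_n e^{-\lambda_n s}\Big|\ \le\ C\,\lambda_N^d\,\|D\|_\infty .$$ -/

import Mathlib

open Filter Topology
open scoped ENNReal

noncomputable section

namespace GeneralDirichlet

/-- A frequency: a strictly increasing sequence of non-negative reals tending to `+∞`.
Sequences are indexed from `0`, so `lam n` is the `(n+1)`-st term `λ_{n+1}`. -/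
structure IsFrequency (lam : ℕ → ℝ) : Prop where
  strictMono : StrictMono lam
  nonneg : ∀ n, 0 ≤ lam n
  tendsto_atTop : Tendsto lam atTop atTop

/-- The growth condition with exponent `d`:
`∃ l > 0, ∀ δ > 0, ∃ C > 0, ∀ n, λ_{n+1} - λ_n ≥ C exp (-(l + δ) λ_n ^ d)`. -/
def PolynomialGrowth (lam : ℕ → ℝ) (d : ℝ) : Prop :=
  ∃ l : ℝ, 0 < l ∧ ∀ δ : ℝ, 0 < δ → ∃ C : ℝ, 0 < C ∧
    ∀ n : ℕ, C * Real.exp (-(l + δ) * lam n ^ d) ≤ lam (n + 1) - lam n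

/-- The sum of the first `N` terms of the Dirichlet series with frequency `lam` and
coefficients `a`, at the point `s`. -/
def partialSum (lam : ℕ → ℝ) (a : ℕ → ℂ) (N : ℕ) (s : ℂ) : ℂ :=
  ∑ n ∈ Finset.range N, a n * Complex.exp (-(lam n : ℂ) * s)

/-- The Dirichlet series converges at `s`, as the limit of its partial sums. -/
def ConvergesAt (lam : ℕ → ℝ) (a : ℕ → ℂ) (s : ℂ) : Prop :=
  ∃ z : ℂ, Tendsto (fun N => partialSum lam a N s) atTop (𝓝 z)

/-- The abscissa of convergence `σ_c`, an extended real number. -/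
def abscissaConv (lam : ℕ → ℝ) (a : ℕ → ℂ) : EReal :=
  sInf (Real.toEReal '' {σ : ℝ | ∀ s : ℂ, σ < s.re → ConvergesAt lam a s})

/-- `f` is a bounded holomorphic function on `[Re > 0]` that coincides with the limit function
of the Dirichlet series on the part of `[Re > 0]` where `Re s > σ_c`. -/
structure IsBoundedExtension (lam : ℕ → ℝ) (a : ℕ → ℂ) (f : ℂ → ℂ) : Prop where
  holomorphic : DifferentiableOn ℂ f {s : ℂ | 0 < s.re}
  bounded : ∃ M : ℝ, ∀ s : ℂ, 0 < s.re → ‖f s‖ ≤ M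
  extends_limit : ∀ s : ℂ, 0 < s.re → abscissaConv lam a < (s.re : EReal) →
    Tendsto (fun N => partialSum lam a N s) atTop (𝓝 (f s))

/-- The space `D_∞^ext(λ)`: all somewhere convergent Dirichlet series (given by their
coefficients) with a bounded holomorphic extension to `[Re > 0]`. -/
def DInftyExt (lam : ℕ → ℝ) : Set (ℕ → ℂ) :=
  {a | (∃ s : ℂ, ConvergesAt lam a s) ∧ ∃ f : ℂ → ℂ, IsBoundedExtension lam a f}

/-- The extension of an element of `D_∞^ext(λ)`. By the identity theorem its restriction to
`[Re > 0]` does not depend on the choice. -/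
def extension {lam : ℕ → ℝ} (D : DInftyExt lam) : ℂ → ℂ :=
  Classical.choose D.2.2

/-- `sup_{Re s > 0} |g s|`, with values in `[0, ∞]`. -/
def halfPlaneSup (g : ℂ → ℂ) : ℝ≥0∞ :=
  ⨆ (s : ℂ) (_ : 0 < s.re), ‖g s‖ₑ

/-- `‖D‖_∞`: the supremum over `[Re > 0]` of the modulus of the extension of `D`. -/
def supNorm {lam : ℕ → ℝ} (D : DInftyExt lam) : ℝ≥0∞ :=
  halfPlaneSup (extension D)

/-- The norm of the partial sum operator `S_N` on `D_∞^ext(λ)` (both sides carrying the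
supremum norm on `[Re > 0]`), with values in `[0, ∞]`. -/
def partialSumOpNorm (lam : ℕ → ℝ) (N : ℕ) : ℝ≥0∞ :=
  ⨆ (D : DInftyExt lam) (_ : supNorm D ≤ 1), halfPlaneSup (partialSum lam D.1 N)

end GeneralDirichlet

end

open MeasureTheory FourierTransform SchwartzMap

namespace GeneralDirichlet

/-! Let `φ` be a smooth cutoff equal to `1` on `[0, A]` and `0` on `[A + h, ∞)`, where `A` is the
last frequency kept and `A + h` does not exceed the next one. By Fourier inversion, integrating `f(s
- 2πit)` against `𝓕 φ` multiplies each coefficient by the value of `φ` at its frequency, so it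
returns exactly the partial sum (`integral_extension_mul_fourier`). Hence the operator norm is at
most the `L¹` norm of `𝓕 φ`.

That norm is only logarithmic, `O(1 + log ((A + 2) / h))` (`exists_cutoff_fourier`), and the gap
condition turns the logarithm into `O(λ_N ^ d)` (`exists_log_div_gap_le`).

The integral formula is proved far to the right, where the series converges, by Abel summation and
dominated convergence. The identity theorem carries it to the whole half-plane. -/

/-! ### Smooth cutoffs and the `L¹` norms of their derivatives. -/

theorem integrable_comp_affine {g : ℝ → ℂ} (hg : Integrable g) {k : ℝ} (hk : 0 < k) (b : ℝ) :
    Integrable (fun x => g (k * x + b)) :=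
  (hg.comp_add_right b).comp_mul_left' hk.ne'

theorem integral_norm_comp_affine (g : ℝ → ℂ) {k : ℝ} (hk : 0 < k) (b : ℝ) :
    ∫ x, ‖g (k * x + b)‖ = k⁻¹ * ∫ x, ‖g x‖ := by
  rw [Measure.integral_comp_mul_left (fun y => ‖g (y + b)‖) k,
    integral_add_right_eq_self (fun y => ‖g y‖) b, abs_of_pos (inv_pos.2 hk), smul_eq_mul]

theorem integral_norm_sub_comp_affine_le {g : ℝ → ℂ} (hg : Integrable g) {k : ℝ} (hk : 0 < k)
    (b₁ b₂ : ℝ) :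
    ∫ x, ‖g (k * x + b₁) - g (k * x + b₂)‖ ≤ 2 * k⁻¹ * ∫ x, ‖g x‖ := by
  have h₁ := integrable_comp_affine hg hk b₁
  have h₂ := integrable_comp_affine hg hk b₂
  calc ∫ x, ‖g (k * x + b₁) - g (k * x + b₂)‖
      ≤ ∫ x, (‖g (k * x + b₁)‖ + ‖g (k * x + b₂)‖) :=
        integral_mono (h₁.sub h₂).norm (h₁.norm.add h₂.norm) fun x => norm_sub_le _ _
    _ = 2 * k⁻¹ * ∫ x, ‖g x‖ := by
        rw [integral_add h₁.norm h₂.norm, integral_norm_comp_affine g hk,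
          integral_norm_comp_affine g hk]
        ring

theorem deriv_sub_comp_affine {g : ℝ → ℂ} (hg : Differentiable ℝ g) (k b₁ b₂ : ℝ) :
    deriv (fun x => g (k * x + b₁) - g (k * x + b₂)) =
      fun x => k • (deriv g (k * x + b₁) - deriv g (k * x + b₂)) := by
  have key : ∀ b x : ℝ, HasDerivAt (fun x => g (k * x + b)) (k • deriv g (k * x + b)) x := by
    intro b x
    have h := ((hasDerivAt_id x).const_mul k).add_const b
    simpa using! (hg (k * x + b)).hasDerivAt.scomp x h
  funext x
  rw [((key b₁ x).fun_sub (key b₂ x)).deriv, smul_sub]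

/-- The smooth step from `0` to `1`, as a complex valued function. -/
noncomputable def smoothStep (x : ℝ) : ℂ := (Real.smoothTransition x : ℂ)

theorem contDiff_smoothStep : ContDiff ℝ ((⊤ : ℕ∞) : WithTop ℕ∞) smoothStep :=
  Complex.ofRealCLM.contDiff.comp Real.smoothTransition.contDiff

theorem hasCompactSupport_deriv_smoothStep : HasCompactSupport (deriv smoothStep) := by
  refine HasCompactSupport.intro (isCompact_Icc (a := (0 : ℝ)) (b := 1)) fun x hx => ?_
  rcases lt_or_ge x 0 with h | h
  · have : smoothStep =ᶠ[𝓝 x] fun _ => 0 := by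
      filter_upwards [Iio_mem_nhds h] with y hy
      simp [smoothStep, Real.smoothTransition.zero_of_nonpos (le_of_lt hy)]
    rw [this.deriv_eq, deriv_const]
  · have h1 : 1 < x := by
      by_contra! hc
      exact hx ⟨h, hc⟩
    have : smoothStep =ᶠ[𝓝 x] fun _ => 1 := by
      filter_upwards [Ioi_mem_nhds h1] with y hy
      simp [smoothStep, Real.smoothTransition.one_of_one_le (le_of_lt hy)]
    rw [this.deriv_eq, deriv_const]

theorem contDiff_deriv_smoothStep :
    ContDiff ℝ ((⊤ : ℕ∞) : WithTop ℕ∞) (deriv smoothStep) :=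
  (contDiff_infty_iff_deriv.1 contDiff_smoothStep).2

/-- Smooth cutoffs that are `1` on `[0, A]` and `0` on `[A + h, ∞)`, with uniform control of the
`L¹` norms of the first two derivatives. -/
theorem exists_cutoff : ∃ c : ℝ, 0 < c ∧ ∀ A h : ℝ, 0 ≤ A → 0 < h → h ≤ 1 →
    ∃ φ : 𝓢(ℝ, ℂ), (∀ x, 0 ≤ x → x ≤ A → φ x = 1) ∧ (∀ x, A + h ≤ x → φ x = 0) ∧
      ∫ x, ‖φ x‖ ≤ A + 2 ∧ ∫ x, ‖deriv φ x‖ ≤ c ∧ ∫ x, ‖deriv (deriv φ) x‖ ≤ c / h := by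
  set g := deriv smoothStep with hg
  have hgi : Integrable g :=
    contDiff_deriv_smoothStep.continuous.integrable_of_hasCompactSupport
      hasCompactSupport_deriv_smoothStep
  have hg'i : Integrable (deriv g) :=
    (contDiff_infty_iff_deriv.1 contDiff_deriv_smoothStep).2.continuous.integrable_of_hasCompactSupport
      hasCompactSupport_deriv_smoothStep.deriv
  have hI₁ : 0 ≤ ∫ x, ‖g x‖ := integral_nonneg fun _ => norm_nonneg _
  have hI₂ : 0 ≤ ∫ x, ‖deriv g x‖ := integral_nonneg fun _ => norm_nonneg _
  refine ⟨2 * (∫ x, ‖g x‖) + 2 * (∫ x, ‖deriv g x‖) + 1, by positivity, ?_⟩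
  intro A h hA hh hh1
  have hk : 0 < h⁻¹ := inv_pos.2 hh
  -- The first step rises on `[-h, 0]`; the second, subtracted, brings the function back to `0` on
  -- `[A, A + h]`.
  set F : ℝ → ℂ := fun x => smoothStep (h⁻¹ * x + 1) - smoothStep (h⁻¹ * x + -(h⁻¹ * A)) with hF
  have hleft : ∀ x, x ≤ -h → F x = 0 := by
    intro x hx
    have h1 : h⁻¹ * x + 1 ≤ 0 := by
      have := mul_le_mul_of_nonneg_left hx hk.le
      rw [mul_neg, inv_mul_cancel₀ hh.ne'] at this
      linarith
    have h2 : h⁻¹ * x + -(h⁻¹ * A) ≤ 0 := by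
      have : 0 ≤ h⁻¹ * A := by positivity
      linarith
    simp [hF, smoothStep, Real.smoothTransition.zero_of_nonpos h1,
      Real.smoothTransition.zero_of_nonpos h2]
  have hright : ∀ x, A + h ≤ x → F x = 0 := by
    intro x hx
    have h2 : 1 ≤ h⁻¹ * x + -(h⁻¹ * A) := by
      have := mul_le_mul_of_nonneg_left hx hk.le
      rw [mul_add, inv_mul_cancel₀ hh.ne'] at this
      linarith
    have h1 : 1 ≤ h⁻¹ * x + 1 := by
      have : 0 ≤ h⁻¹ * A := by positivity
      linarith
    simp [hF, smoothStep, Real.smoothTransition.one_of_one_le h1,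
      Real.smoothTransition.one_of_one_le h2]
  have hone : ∀ x, 0 ≤ x → x ≤ A → F x = 1 := by
    intro x hx hxA
    have h1 : 1 ≤ h⁻¹ * x + 1 := by
      have : 0 ≤ h⁻¹ * x := by positivity
      linarith
    have h2 : h⁻¹ * x + -(h⁻¹ * A) ≤ 0 := by
      have := mul_le_mul_of_nonneg_left hxA hk.le
      linarith
    simp [hF, smoothStep, Real.smoothTransition.one_of_one_le h1,
      Real.smoothTransition.zero_of_nonpos h2]
  have hle : ∀ x, ‖F x‖ ≤ 1 := by
    intro x
    have : F x = ((Real.smoothTransition (h⁻¹ * x + 1) -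
        Real.smoothTransition (h⁻¹ * x + -(h⁻¹ * A)) : ℝ) : ℂ) := by simp [hF, smoothStep]
    rw [this, Complex.norm_real, Real.norm_eq_abs, abs_le]
    have := Real.smoothTransition.nonneg (h⁻¹ * x + 1)
    have := Real.smoothTransition.nonneg (h⁻¹ * x + -(h⁻¹ * A))
    have := Real.smoothTransition.le_one (h⁻¹ * x + 1)
    have := Real.smoothTransition.le_one (h⁻¹ * x + -(h⁻¹ * A))
    constructor <;> linarith
  have hsupp : HasCompactSupport F := by
    refine HasCompactSupport.intro (isCompact_Icc (a := -h) (b := A + h)) fun x hx => ?_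
    by_cases hx1 : x ≤ -h
    · exact hleft x hx1
    · refine hright x (le_of_not_ge fun hc => hx ⟨le_of_not_ge hx1, hc⟩)
  have hsmooth : ContDiff ℝ ((⊤ : ℕ∞) : WithTop ℕ∞) F :=
    (contDiff_smoothStep.comp (by fun_prop)).sub (contDiff_smoothStep.comp (by fun_prop))
  -- Each derivative produces a factor `h⁻¹`, and rescaling the integral gives back one factor `h`:
  -- the first derivative has `L¹` norm `O(1)`, the second `O(1 / h)`.
  have hdF : deriv F = fun x => h⁻¹ • (g (h⁻¹ * x + 1) - g (h⁻¹ * x + -(h⁻¹ * A))) :=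
    deriv_sub_comp_affine (contDiff_smoothStep.differentiable (by simp)) _ _ _
  have hgd : Differentiable ℝ g := contDiff_deriv_smoothStep.differentiable (by simp)
  have hddF : deriv (deriv F) = fun x => h⁻¹ • (h⁻¹ •
      (deriv g (h⁻¹ * x + 1) - deriv g (h⁻¹ * x + -(h⁻¹ * A)))) := by
    rw [hdF]
    funext x
    rw [deriv_fun_const_smul _ (by fun_prop), deriv_sub_comp_affine hgd]
  refine ⟨hsupp.toSchwartzMap hsmooth, hone, hright, ?_, ?_, ?_⟩
  · change ∫ x, ‖F x‖ ≤ A + 2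
    have : ∫ x, ‖F x‖ = ∫ x in Set.Icc (-h) (A + h), ‖F x‖ := by
      rw [setIntegral_eq_integral_of_forall_compl_eq_zero]
      intro x hx
      by_cases hx1 : x ≤ -h
      · simp [hleft x hx1]
      · simp [hright x (le_of_not_ge fun hc => hx ⟨le_of_not_ge hx1, hc⟩)]
    rw [this]
    calc ∫ x in Set.Icc (-h) (A + h), ‖F x‖ ≤ ∫ x in Set.Icc (-h) (A + h), (1 : ℝ) :=
          setIntegral_mono (hsmooth.continuous.integrable_of_hasCompactSupport hsupp).norm.integrableOn
            (by simp) hle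
      _ = A + 2 * h := by
          simp only [integral_const, MeasurableSet.univ, measureReal_restrict_apply, Set.univ_inter,
            smul_eq_mul, mul_one, Real.volume_real_Icc]
          rw [max_eq_left (by linarith)]
          ring
      _ ≤ A + 2 := by linarith
  · change ∫ x, ‖deriv F x‖ ≤ _
    rw [hdF]
    simp only [norm_smul, integral_const_mul]
    have := integral_norm_sub_comp_affine_le hgi hk 1 (-(h⁻¹ * A))
    have := mul_le_mul_of_nonneg_left this (norm_nonneg h⁻¹)
    refine this.trans ?_
    rw [Real.norm_of_nonneg hk.le, inv_inv]
    have : h⁻¹ * (2 * h * ∫ x, ‖g x‖) = 2 * ∫ x, ‖g x‖ := by field_simp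
    rw [this]
    linarith
  · change ∫ x, ‖deriv (deriv F) x‖ ≤ _
    rw [hddF]
    simp only [norm_smul, integral_const_mul]
    have := integral_norm_sub_comp_affine_le hg'i hk 1 (-(h⁻¹ * A))
    have := mul_le_mul_of_nonneg_left (mul_le_mul_of_nonneg_left this (norm_nonneg h⁻¹))
      (norm_nonneg h⁻¹)
    refine this.trans ?_
    rw [Real.norm_of_nonneg hk.le, inv_inv]
    have : h⁻¹ * (h⁻¹ * (2 * h * ∫ x, ‖deriv g x‖)) = (2 * ∫ x, ‖deriv g x‖) / h := by field_simp
    rw [this]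
    gcongr
    linarith

/-! ### Logarithmic `L¹` bound for the Fourier transform. -/

/-- Split at `1 / R` and `1 / h`, where consecutive bounds among `R`, `c / t` and `c / (h t²)` cross
up to constants. The three pieces contribute `1`, `c log (R / h)` and `c`. -/
theorem setIntegral_Ioi_norm_le {g : ℝ → ℂ} (hg : Integrable g) {R h c : ℝ} (hR : 1 ≤ R)
    (hh : 0 < h) (hh1 : h ≤ 1) (h₀ : ∀ t, ‖g t‖ ≤ R) (h₁ : ∀ t, |t| * ‖g t‖ ≤ c)
    (h₂ : ∀ t, t ^ 2 * ‖g t‖ ≤ c / h) :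
    ∫ t in Set.Ioi 0, ‖g t‖ ≤ 1 + c * Real.log (R / h) + c := by
  have hR0 : 0 < R := by linarith
  have hab : R⁻¹ ≤ h⁻¹ := inv_anti₀ hh (hh1.trans hR)
  have hRi : 0 < R⁻¹ := inv_pos.2 hR0
  have hhi : 0 < h⁻¹ := inv_pos.2 hh
  have hgn := hg.norm
  rw [← Set.Ioc_union_Ioi_eq_Ioi (hRi.le.trans hab), setIntegral_union
    (Set.Ioc_disjoint_Ioi le_rfl) measurableSet_Ioi hgn.integrableOn hgn.integrableOn,
    ← Set.Ioc_union_Ioc_eq_Ioc hRi.le hab, setIntegral_union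
    (Set.Ioc_disjoint_Ioc_of_le le_rfl) measurableSet_Ioc hgn.integrableOn hgn.integrableOn]
  have e₀ : ∫ t in Set.Ioc 0 R⁻¹, ‖g t‖ ≤ 1 := by
    calc ∫ t in Set.Ioc 0 R⁻¹, ‖g t‖ ≤ ∫ t in Set.Ioc 0 R⁻¹, R :=
          setIntegral_mono hgn.integrableOn (by simp) h₀
      _ = 1 := by simp [hRi.le, hR0.ne']
  have e₁ : ∫ t in Set.Ioc R⁻¹ h⁻¹, ‖g t‖ ≤ c * Real.log (R / h) := by
    have hint : IntervalIntegrable (fun t : ℝ => c * t⁻¹) volume R⁻¹ h⁻¹ := by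
      refine (intervalIntegral.intervalIntegrable_inv (fun x hx => ?_) continuousOn_id).const_mul c
      rw [Set.uIcc_of_le hab] at hx
      exact (hRi.trans_le hx.1).ne'
    calc ∫ t in Set.Ioc R⁻¹ h⁻¹, ‖g t‖ ≤ ∫ t in Set.Ioc R⁻¹ h⁻¹, c * t⁻¹ := by
          refine setIntegral_mono_on hgn.integrableOn
            ((intervalIntegrable_iff_integrableOn_Ioc_of_le hab).1 hint) measurableSet_Ioc ?_
          intro t ht
          have ht0 : 0 < t := hRi.trans ht.1
          have := h₁ t
          rw [abs_of_pos ht0] at this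
          rw [← div_eq_mul_inv, le_div_iff₀ ht0]
          linarith
      _ = c * Real.log (R / h) := by
          rw [← intervalIntegral.integral_of_le hab, intervalIntegral.integral_const_mul,
            integral_inv_of_pos hRi hhi]
          congr 2
          field_simp
  have e₂ : ∫ t in Set.Ioi h⁻¹, ‖g t‖ ≤ c := by
    calc ∫ t in Set.Ioi h⁻¹, ‖g t‖ ≤ ∫ t in Set.Ioi h⁻¹, c / h * t ^ (-2 : ℝ) := by
          refine setIntegral_mono_on hgn.integrableOn
            ((integrableOn_Ioi_rpow_of_lt (by norm_num) hhi).const_mul _) measurableSet_Ioi ?_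
          intro t ht
          have ht0 : 0 < t := hhi.trans ht
          rw [Real.rpow_neg ht0.le, ← div_eq_mul_inv, Real.rpow_two, le_div_iff₀ (by positivity)]
          linarith [h₂ t]
      _ = c := by
          rw [integral_const_mul, integral_Ioi_rpow_of_lt (by norm_num) hhi]
          norm_num [Real.rpow_neg hhi.le]
          field_simp
  linarith

theorem integral_norm_le {g : ℝ → ℂ} (hg : Integrable g) {R h c : ℝ} (hR : 1 ≤ R)
    (hh : 0 < h) (hh1 : h ≤ 1) (h₀ : ∀ t, ‖g t‖ ≤ R) (h₁ : ∀ t, |t| * ‖g t‖ ≤ c)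
    (h₂ : ∀ t, t ^ 2 * ‖g t‖ ≤ c / h) :
    ∫ t, ‖g t‖ ≤ 2 * (1 + c * Real.log (R / h) + c) := by
  have e₁ := setIntegral_Ioi_norm_le hg hR hh hh1 h₀ h₁ h₂
  have e₂ := setIntegral_Ioi_norm_le hg.comp_neg hR hh hh1 (fun t => h₀ (-t))
    (fun t => by simpa using h₁ (-t)) (fun t => by simpa using h₂ (-t))
  rw [integral_comp_neg_Ioi (f := fun t => ‖g t‖), neg_zero] at e₂
  rw [← intervalIntegral.integral_Iic_add_Ioi hg.norm.integrableOn hg.norm.integrableOn (b := 0)]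
  linarith

/-- Cutoff functions as in `exists_cutoff`, with a logarithmic bound for the `L¹` norm of the
Fourier transform. -/
theorem exists_cutoff_fourier : ∃ c : ℝ, 0 < c ∧ ∀ A h : ℝ, 0 ≤ A → 0 < h → h ≤ 1 →
    ∃ φ : 𝓢(ℝ, ℂ), (∀ x, 0 ≤ x → x ≤ A → φ x = 1) ∧ (∀ x, A + h ≤ x → φ x = 0) ∧
      ∫ t, ‖𝓕 φ t‖ ≤ c * (1 + Real.log ((A + 2) / h)) := by
  obtain ⟨c, hc, H⟩ := exists_cutoff
  refine ⟨2 * (1 + c), by positivity, fun A h hA hh hh1 => ?_⟩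
  obtain ⟨φ, hone, hzero, i₀, i₁, i₂⟩ := H A h hA hh hh1
  refine ⟨φ, hone, hzero, ?_⟩
  have hbd : ∀ (u : ℝ → ℂ) (t : ℝ), ‖𝓕 u t‖ ≤ ∫ x, ‖u x‖ := fun u t =>
    VectorFourier.norm_fourierIntegral_le_integral_norm _ _ _ _ _
  have d₀ : Integrable φ := φ.integrable
  have d₁ : Integrable (deriv φ) := (derivCLM ℂ ℂ φ).integrable
  have d₂ : Integrable (deriv (deriv φ)) := (derivCLM ℂ ℂ (derivCLM ℂ ℂ φ)).integrable
  have f₁ := Real.fourier_deriv d₀ φ.differentiable d₁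
  have f₂ := Real.fourier_deriv d₁ (derivCLM ℂ ℂ φ).differentiable d₂
  have hpi : (1 : ℝ) ≤ 2 * Real.pi := by linarith [Real.pi_gt_three]
  have n₁ : ∀ t : ℝ, 2 * Real.pi * |t| * ‖𝓕 (φ : ℝ → ℂ) t‖ = ‖𝓕 (deriv φ) t‖ := by
    intro t
    rw [f₁]
    simp [abs_of_pos Real.pi_pos]
  have n₂ : ∀ t : ℝ, 2 * Real.pi * |t| * ‖𝓕 (deriv φ) t‖ = ‖𝓕 (deriv (deriv φ)) t‖ := by
    intro t
    rw [f₂]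
    simp [abs_of_pos Real.pi_pos]
  have key := integral_norm_le (g := (𝓕 φ : 𝓢(ℝ, ℂ))) (𝓕 φ : 𝓢(ℝ, ℂ)).integrable (R := A + 2) (h := h) (c := c)
    (by linarith) hh hh1 (fun t => (hbd φ t).trans i₀) (fun t => ?_) (fun t => ?_)
  · refine key.trans ?_
    have hlog : 0 ≤ Real.log ((A + 2) / h) :=
      Real.log_nonneg (by rw [le_div_iff₀ hh]; linarith)
    nlinarith
  · change |t| * ‖𝓕 (φ : ℝ → ℂ) t‖ ≤ c
    have := (n₁ t).le.trans ((hbd _ t).trans i₁)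
    have hp : 0 ≤ |t| * ‖𝓕 (φ : ℝ → ℂ) t‖ := by positivity
    nlinarith
  · change t ^ 2 * ‖𝓕 (φ : ℝ → ℂ) t‖ ≤ c / h
    have h2 := (n₂ t).le.trans ((hbd _ t).trans i₂)
    rw [← n₁ t] at h2
    have hp : 0 ≤ t ^ 2 * ‖𝓕 (φ : ℝ → ℂ) t‖ := by positivity
    have : 2 * Real.pi * |t| * (2 * Real.pi * |t| * ‖𝓕 (φ : ℝ → ℂ) t‖)
        = (2 * Real.pi) ^ 2 * (t ^ 2 * ‖𝓕 (φ : ℝ → ℂ) t‖) := by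
      rw [← sq_abs t]; ring
    rw [this] at h2
    have : (1 : ℝ) ≤ (2 * Real.pi) ^ 2 := one_le_pow₀ hpi
    nlinarith

/-! ### Abel summation and convergence to the right of a point. -/

/-- The difference is the integral of `w e^{-uw}` over `[a, b]`. Bounding it by an integral of real
exponentials gives a right-hand side that telescopes when summed over the frequencies. -/
theorem norm_cexp_sub_cexp_le {w : ℂ} (hw : 0 < w.re) {a b : ℝ} (hab : a ≤ b) :
    ‖Complex.exp (-(a : ℂ) * w) - Complex.exp (-(b : ℂ) * w)‖ ≤
      ‖w‖ / w.re * (Real.exp (-a * w.re) - Real.exp (-b * w.re)) := by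
  have e₁ : ∫ u in a..b, w * Complex.exp (-(u : ℂ) * w) =
      Complex.exp (-(a : ℂ) * w) - Complex.exp (-(b : ℂ) * w) := by
    rw [intervalIntegral.integral_eq_sub_of_hasDerivAt
      (f := fun u : ℝ => -Complex.exp (-(u : ℂ) * w)) (fun u _ => ?_)
      (Continuous.intervalIntegrable (by fun_prop) _ _)]
    · ring
    · have := ((((Complex.ofRealCLM.hasDerivAt (x := u)).neg).mul_const w).cexp).neg
      convert! this using 1
      simp
      ring
  have e₂ : ∫ u in a..b, ‖w‖ * Real.exp (-u * w.re) =
      ‖w‖ / w.re * (Real.exp (-a * w.re) - Real.exp (-b * w.re)) := by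
    rw [intervalIntegral.integral_eq_sub_of_hasDerivAt
      (f := fun u : ℝ => -(‖w‖ / w.re * Real.exp (-u * w.re))) (fun u _ => ?_)
      (Continuous.intervalIntegrable (by fun_prop) _ _)]
    · ring
    · have := ((((hasDerivAt_id u).neg.mul_const w.re).exp).const_mul (‖w‖ / w.re)).neg
      convert! this using 1
      simp
      field_simp
  rw [← e₁, ← e₂]
  refine intervalIntegral.norm_integral_le_of_norm_le hab (ae_of_all _ fun u _ => ?_)
    (Continuous.intervalIntegrable (by fun_prop) _ _)
  rw [norm_mul, Complex.norm_exp]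
  simp

theorem sum_mul_eq_abel (b e : ℕ → ℂ) (N : ℕ) :
    ∑ n ∈ Finset.range N, b n * e n = (∑ n ∈ Finset.range N, b n) * e N +
      ∑ n ∈ Finset.range N, (∑ m ∈ Finset.range (n + 1), b m) * (e n - e (n + 1)) := by
  induction N with
  | zero => simp
  | succ N ih =>
    rw [Finset.sum_range_succ, ih, Finset.sum_range_succ _ N,
      Finset.sum_range_succ (fun n => (∑ m ∈ Finset.range (n + 1), b m) * (e n - e (n + 1))) N,
      Finset.sum_range_succ b N]
    ring

variable {lam : ℕ → ℝ} {a : ℕ → ℂ} {s₀ s : ℂ}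

theorem partialSum_eq_abel (lam : ℕ → ℝ) (a : ℕ → ℂ) (s₀ s : ℂ) (N : ℕ) :
    partialSum lam a N s = partialSum lam a N s₀ * Complex.exp (-(lam N : ℂ) * (s - s₀)) +
      ∑ n ∈ Finset.range N, partialSum lam a (n + 1) s₀ *
        (Complex.exp (-(lam n : ℂ) * (s - s₀)) - Complex.exp (-(lam (n + 1) : ℂ) * (s - s₀))) := by
  unfold partialSum
  rw [← sum_mul_eq_abel (fun n => a n * Complex.exp (-(lam n : ℂ) * s₀))
    (fun n => Complex.exp (-(lam n : ℂ) * (s - s₀)))]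
  refine Finset.sum_congr rfl fun n _ => ?_
  rw [mul_assoc, ← Complex.exp_add]
  congr 2
  ring

theorem sum_norm_abel_le (hlam : IsFrequency lam) {K : ℝ}
    (hK : ∀ N, ‖partialSum lam a N s₀‖ ≤ K) (hs : s₀.re < s.re) (N : ℕ) :
    ∑ n ∈ Finset.range N, ‖partialSum lam a (n + 1) s₀ *
        (Complex.exp (-(lam n : ℂ) * (s - s₀)) - Complex.exp (-(lam (n + 1) : ℂ) * (s - s₀)))‖ ≤
      K * (‖s - s₀‖ / (s.re - s₀.re)) := by
  have hw : 0 < (s - s₀).re := by simpa using hs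
  have hK0 : 0 ≤ K := (norm_nonneg _).trans (hK 0)
  calc _ ≤ ∑ n ∈ Finset.range N, K * (‖s - s₀‖ / (s - s₀).re *
        (Real.exp (-lam n * (s - s₀).re) - Real.exp (-lam (n + 1) * (s - s₀).re))) := by
        refine Finset.sum_le_sum fun n _ => ?_
        rw [norm_mul]
        exact mul_le_mul (hK _) (norm_cexp_sub_cexp_le hw (hlam.strictMono.monotone n.le_succ))
          (norm_nonneg _) hK0
    _ = K * (‖s - s₀‖ / (s - s₀).re *
        (Real.exp (-lam 0 * (s - s₀).re) - Real.exp (-lam N * (s - s₀).re))) := by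
        rw [← Finset.mul_sum, ← Finset.mul_sum,
          Finset.sum_range_sub' (fun n => Real.exp (-lam n * (s - s₀).re))]
    _ ≤ K * (‖s - s₀‖ / (s - s₀).re * 1) := by
        gcongr
        have h0 : Real.exp (-lam 0 * (s - s₀).re) ≤ 1 := by
          rw [Real.exp_le_one_iff]
          nlinarith [hlam.nonneg 0]
        linarith [Real.exp_pos (-lam N * (s - s₀).re)]
    _ = _ := by simp

/-- On a vertical line this bound is uniform in `N` and grows at most linearly in the height, so it
is integrable against a Schwartz function. -/
theorem norm_partialSum_le (hlam : IsFrequency lam) {K : ℝ}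
    (hK : ∀ N, ‖partialSum lam a N s₀‖ ≤ K) (hs : s₀.re < s.re) (N : ℕ) :
    ‖partialSum lam a N s‖ ≤ K * (1 + ‖s - s₀‖ / (s.re - s₀.re)) := by
  have hw : 0 < (s - s₀).re := by simpa using hs
  have hK0 : 0 ≤ K := (norm_nonneg _).trans (hK 0)
  rw [partialSum_eq_abel lam a s₀ s N, mul_add]
  refine (norm_add_le _ _).trans (add_le_add ?_
    ((norm_sum_le _ _).trans (sum_norm_abel_le hlam hK hs N)))
  rw [norm_mul]
  refine mul_le_mul (hK N) ?_ (norm_nonneg _) hK0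
  rw [Complex.norm_exp, Real.exp_le_one_iff]
  have : (-(lam N : ℂ) * (s - s₀)).re = -lam N * (s - s₀).re := by simp
  rw [this]
  nlinarith [hlam.nonneg N]

theorem convergesAt_of_re_lt (hlam : IsFrequency lam) {K : ℝ}
    (hK : ∀ N, ‖partialSum lam a N s₀‖ ≤ K) (hs : s₀.re < s.re) : ConvergesAt lam a s := by
  have hw : 0 < (s - s₀).re := by simpa using hs
  have hsum := (summable_of_sum_range_le (fun _ => norm_nonneg _)
    (sum_norm_abel_le hlam hK hs)).of_norm.hasSum.tendsto_sum_nat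
  have hexp : Tendsto (fun N => Complex.exp (-(lam N : ℂ) * (s - s₀))) atTop (𝓝 0) := by
    rw [tendsto_zero_iff_norm_tendsto_zero]
    have : ∀ N, ‖Complex.exp (-(lam N : ℂ) * (s - s₀))‖ = Real.exp (-(lam N * (s - s₀).re)) := by
      intro N
      rw [Complex.norm_exp]
      simp
    simp only [this]
    exact Real.tendsto_exp_neg_atTop_nhds_zero.comp (hlam.tendsto_atTop.atTop_mul_const hw)
  have hzero : Tendsto (fun N => partialSum lam a N s₀ * Complex.exp (-(lam N : ℂ) * (s - s₀)))
      atTop (𝓝 0) :=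
    (hexp.zero_mul_isBoundedUnder_le (isBoundedUnder_of ⟨K, hK⟩)).congr fun N => mul_comm _ _
  refine ⟨_, (hzero.add hsum).congr fun N => (partialSum_eq_abel lam a s₀ s N).symm⟩

theorem abscissaConv_le (hlam : IsFrequency lam) {K : ℝ}
    (hK : ∀ N, ‖partialSum lam a N s₀‖ ≤ K) : abscissaConv lam a ≤ (s₀.re : EReal) :=
  sInf_le ⟨s₀.re, fun _ hs => convergesAt_of_re_lt hlam hK hs, rfl⟩

theorem ConvergesAt.exists_norm_le (h : ConvergesAt lam a s₀) :
    ∃ K, ∀ N, ‖partialSum lam a N s₀‖ ≤ K := by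
  obtain ⟨z, hz⟩ := h
  obtain ⟨K, hK⟩ := (Metric.isBounded_range_of_tendsto _ hz).exists_norm_le
  exact ⟨K, fun N => hK _ ⟨N, rfl⟩⟩

/-! ### Smoothing along vertical lines. -/

theorem integral_cexp_mul_fourier (φ : 𝓢(ℝ, ℂ)) (x : ℝ) :
    ∫ t : ℝ, Complex.exp (2 * Real.pi * Complex.I * (x * t)) * 𝓕 φ t = φ x := by
  have h : 𝓕⁻ (𝓕 φ) = φ := FourierTransform.fourierInv_fourier_eq φ
  have h' := congrArg (fun ψ : 𝓢(ℝ, ℂ) => ψ x) h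
  simp only [SchwartzMap.fourierInv_coe, Real.fourierInv_eq'] at h'
  rw [← h']
  refine integral_congr_ae (ae_of_all _ fun t => ?_)
  simp only [smul_eq_mul]
  congr 2
  simp
  ring

/-- The point `s - 2πit` of the vertical line through `s`. -/
noncomputable def vshift (s : ℂ) (t : ℝ) : ℂ := s - 2 * Real.pi * Complex.I * t

@[simp] theorem vshift_re (s : ℂ) (t : ℝ) : (vshift s t).re = s.re := by simp [vshift]

theorem continuous_vshift (s : ℂ) : Continuous (vshift s) := by
  unfold vshift
  fun_prop

theorem continuous_partialSum (lam : ℕ → ℝ) (a : ℕ → ℂ) (N : ℕ) :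
    Continuous (partialSum lam a N) := by
  unfold partialSum
  fun_prop

theorem differentiable_partialSum (lam : ℕ → ℝ) (a : ℕ → ℂ) (N : ℕ) :
    Differentiable ℂ (partialSum lam a N) := by
  unfold partialSum
  fun_prop

/-- Moving from `s` to `s - 2πit` multiplies the `n`-th term by `e^{2πi λ_n t}`, and Fourier
inversion integrates this character to `φ (λ_n)`. -/
theorem integral_partialSum_mul_fourier (lam : ℕ → ℝ) (a : ℕ → ℂ) (φ : 𝓢(ℝ, ℂ)) (M : ℕ) (s : ℂ) :
    ∫ t : ℝ, partialSum lam a M (vshift s t) * 𝓕 φ t =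
      ∑ n ∈ Finset.range M, a n * Complex.exp (-(lam n : ℂ) * s) * φ (lam n) := by
  have hterm : ∀ t : ℝ, partialSum lam a M (vshift s t) * 𝓕 φ t =
      ∑ n ∈ Finset.range M, a n * Complex.exp (-(lam n : ℂ) * s) *
        (Complex.exp (2 * Real.pi * Complex.I * (lam n * t)) * 𝓕 φ t) := by
    intro t
    rw [partialSum, Finset.sum_mul]
    refine Finset.sum_congr rfl fun n _ => ?_
    have : Complex.exp (-(lam n : ℂ) * vshift s t) = Complex.exp (-(lam n : ℂ) * s) *
        Complex.exp (2 * Real.pi * Complex.I * (lam n * t)) := by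
      rw [← Complex.exp_add, vshift]
      congr 1
      ring
    rw [this]
    ring
  simp only [hterm]
  rw [integral_finsetSum]
  · refine Finset.sum_congr rfl fun n _ => ?_
    rw [integral_const_mul, integral_cexp_mul_fourier]
  · intro n _
    refine Integrable.const_mul ?_ _
    refine (𝓕 φ : 𝓢(ℝ, ℂ)).integrable.bdd_mul (c := 1)
      (Continuous.aestronglyMeasurable (by fun_prop)) (ae_of_all _ fun t => ?_)
    rw [Complex.norm_exp]
    simp

theorem partialSum_eq_sum_mul {φ : ℝ → ℂ} {N M : ℕ} (hNM : N ≤ M)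
    (hone : ∀ n, n < N → φ (lam n) = 1) (hzero : ∀ n, N ≤ n → φ (lam n) = 0) :
    ∑ n ∈ Finset.range M, a n * Complex.exp (-(lam n : ℂ) * s) * φ (lam n) =
      partialSum lam a N s := by
  rw [partialSum, ← Finset.sum_subset (Finset.range_mono hNM)]
  · refine Finset.sum_congr rfl fun n hn => ?_
    rw [hone n (Finset.mem_range.1 hn), mul_one]
  · intro n _ hn
    rw [hzero n (by simpa using hn), mul_zero]

/-- Far to the right, smoothing the limit function along vertical lines with the Fourier
transform of a cutoff produces the partial sum. -/
theorem integral_extension_mul_fourier_of_re_lt (hlam : IsFrequency lam) {f : ℂ → ℂ}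
    (hf : IsBoundedExtension lam a f) (h₀ : ConvergesAt lam a s₀) (hs : s₀.re < s.re)
    (hs' : 0 < s.re) (φ : 𝓢(ℝ, ℂ)) {N : ℕ}
    (hone : ∀ n, n < N → φ (lam n) = 1) (hzero : ∀ n, N ≤ n → φ (lam n) = 0) :
    ∫ t : ℝ, f (vshift s t) * 𝓕 φ t = partialSum lam a N s := by
  obtain ⟨K, hK⟩ := h₀.exists_norm_le
  have hK0 : 0 ≤ K := (norm_nonneg _).trans (hK 0)
  have hx : 0 < s.re - s₀.re := sub_pos.2 hs
  have hlim : ∀ t, Tendsto (fun M => partialSum lam a M (vshift s t) * 𝓕 φ t) atTop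
      (𝓝 (f (vshift s t) * 𝓕 φ t)) := fun t => by
    refine (hf.extends_limit _ (by simpa using hs') ?_).mul_const _
    rw [vshift_re]
    exact (abscissaConv_le hlam hK).trans_lt (EReal.coe_lt_coe_iff.2 hs)
  -- The dominating function: the linear bound of `norm_partialSum_le` times `‖𝓕 φ t‖`.
  have hint : Integrable fun t : ℝ => K * (1 + ‖s - s₀‖ / (s.re - s₀.re)) * ‖𝓕 φ t‖ +
      K * (2 * Real.pi / (s.re - s₀.re)) * (‖t‖ ^ 1 * ‖𝓕 φ t‖) :=
    ((𝓕 φ : 𝓢(ℝ, ℂ)).integrable.norm.const_mul _).add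
      (((𝓕 φ : 𝓢(ℝ, ℂ)).integrable_pow_mul volume 1).const_mul _)
  have hdom := tendsto_integral_of_dominated_convergence
    (F := fun M t => partialSum lam a M (vshift s t) * 𝓕 φ t) _
    (fun M => (((continuous_partialSum lam a M).comp (continuous_vshift s)).mul
      (𝓕 φ : 𝓢(ℝ, ℂ)).continuous).aestronglyMeasurable) hint
    (fun M => ae_of_all _ fun t => ?_) (ae_of_all _ hlim)
  -- Since `φ` vanishes at all frequencies of index at least `N`, the integrals are constant once `M
  -- ≥ N`.
  · refine tendsto_nhds_unique hdom (tendsto_const_nhds.congr' ?_)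
    filter_upwards [eventually_ge_atTop N] with M hM
    rw [integral_partialSum_mul_fourier, partialSum_eq_sum_mul hM hone hzero]
  · rw [norm_mul]
    have h1 := norm_partialSum_le (s := vshift s t) hlam hK (by simpa using hs) M
    rw [vshift_re] at h1
    have h2 : ‖vshift s t - s₀‖ ≤ ‖s - s₀‖ + 2 * Real.pi * ‖t‖ := by
      have : vshift s t - s₀ = (s - s₀) - 2 * Real.pi * Complex.I * t := by
        rw [vshift]; ring
      rw [this]
      refine (norm_sub_le _ _).trans (le_of_eq ?_)
      simp [abs_of_pos Real.pi_pos]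
    calc _ ≤ K * (1 + (‖s - s₀‖ + 2 * Real.pi * ‖t‖) / (s.re - s₀.re)) * ‖𝓕 φ t‖ := by
          refine mul_le_mul_of_nonneg_right (h1.trans ?_) (norm_nonneg _)
          gcongr
      _ = _ := by ring

/-! ### Continuation of the integral formula to the half-plane. -/

theorem isOpen_rightHalfPlane : IsOpen {s : ℂ | 0 < s.re} :=
  isOpen_lt continuous_const Complex.continuous_re

/-- Smoothing a bounded holomorphic function along vertical lines preserves holomorphy. -/
theorem differentiableOn_integral_vshift {f : ℂ → ℂ}
    (hf : DifferentiableOn ℂ f {s : ℂ | 0 < s.re}) {B : ℝ}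
    (hB : ∀ s : ℂ, 0 < s.re → ‖f s‖ ≤ B) {k : ℝ → ℂ} (hk : Integrable k) :
    DifferentiableOn ℂ (fun s => ∫ t : ℝ, f (vshift s t) * k t) {s : ℂ | 0 < s.re} := by
  intro z (hz : 0 < z.re)
  have hr : 0 < z.re / 2 := by positivity
  have hball : ∀ w ∈ Metric.ball z (z.re / 2), z.re / 2 < w.re := by
    intro w hw
    have h1 : |(w - z).re| < z.re / 2 :=
      (Complex.abs_re_le_norm _).trans_lt (by simpa [dist_eq_norm] using hw)
    rw [Complex.sub_re, abs_lt] at h1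
    linarith
  have hcont : ∀ w : ℂ, 0 < w.re → Continuous fun t => f (vshift w t) := fun w hw =>
    hf.continuousOn.comp_continuous (continuous_vshift w) fun t => by simpa using hw
  have hcont' : Continuous fun t => deriv f (vshift z t) :=
    (hf.deriv isOpen_rightHalfPlane).continuousOn.comp_continuous (continuous_vshift z)
      fun t => by simpa using hz
  -- Cauchy's estimate on a disc of radius `z.re / 2`, which stays in the half-plane, bounds the
  -- derivative uniformly in `t`.
  have hderiv : ∀ w : ℂ, z.re / 2 < w.re → ‖deriv f w‖ ≤ B / (z.re / 2) := by
    intro w hw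
    have hsub : Metric.closedBall w (z.re / 2) ⊆ {s : ℂ | 0 < s.re} := by
      intro u hu
      have h1 : |(u - w).re| ≤ z.re / 2 :=
        (Complex.abs_re_le_norm _).trans (by simpa [dist_eq_norm] using hu)
      rw [Complex.sub_re, abs_le] at h1
      simp only [Set.mem_ofPred_eq]
      linarith
    refine Complex.norm_deriv_le_of_forall_mem_sphere_norm_le hr ?_ fun u hu =>
      hB u (hsub (Metric.sphere_subset_closedBall hu))
    refine DifferentiableOn.diffContOnCl ?_
    exact hf.mono (Metric.closure_ball_subset_closedBall.trans hsub)
  refine (hasDerivAt_integral_of_dominated_loc_of_deriv_le (𝕜 := ℂ)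
    (F' := fun w t => deriv f (vshift w t) * k t) (bound := fun t => B / (z.re / 2) * ‖k t‖)
    (Metric.ball_mem_nhds z hr) ?_ ?_ ?_ ?_ (hk.norm.const_mul _) ?_).2.differentiableAt
    |>.differentiableWithinAt
  · filter_upwards [isOpen_rightHalfPlane.mem_nhds hz] with w hw
    exact (hcont w hw).aestronglyMeasurable.mul hk.aestronglyMeasurable
  · exact hk.bdd_mul (c := B) (hcont z hz).aestronglyMeasurable
      (ae_of_all _ fun t => hB _ (by simpa using hz))
  · exact hcont'.aestronglyMeasurable.mul hk.aestronglyMeasurable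
  · refine ae_of_all _ fun t w hw => ?_
    rw [norm_mul]
    exact mul_le_mul_of_nonneg_right (hderiv _ (by simpa using hball w hw)) (norm_nonneg _)
  · refine ae_of_all _ fun t w hw => ?_
    have hw0 : 0 < (vshift w t).re := by
      rw [vshift_re]
      exact hr.trans (hball w hw)
    have h1 := (hf.differentiableAt (isOpen_rightHalfPlane.mem_nhds hw0)).hasDerivAt
    have h2 : HasDerivAt (fun w => vshift w t) 1 w := (hasDerivAt_id w).sub_const _
    simpa using! (h1.comp w h2).mul_const (k t)

theorem integral_extension_mul_fourier (hlam : IsFrequency lam) {f : ℂ → ℂ}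
    (hf : IsBoundedExtension lam a f) (h₀ : ConvergesAt lam a s₀) (hs : 0 < s.re)
    (φ : 𝓢(ℝ, ℂ)) {N : ℕ}
    (hone : ∀ n, n < N → φ (lam n) = 1) (hzero : ∀ n, N ≤ n → φ (lam n) = 0) :
    ∫ t : ℝ, f (vshift s t) * 𝓕 φ t = partialSum lam a N s := by
  obtain ⟨B, hB⟩ := hf.bounded
  have hG := (differentiableOn_integral_vshift hf.holomorphic hB
    (𝓕 φ : 𝓢(ℝ, ℂ)).integrable).analyticOnNhd isOpen_rightHalfPlane
  have hP := (differentiable_partialSum lam a N).differentiableOn.analyticOnNhd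
    isOpen_rightHalfPlane
  have hconn : IsPreconnected {s : ℂ | 0 < s.re} := (convex_halfSpace_re_gt 0).isPreconnected
  -- A real point to the right of both `s₀` and the imaginary axis; near it the formula is already
  -- known.
  set p : ℂ := ((max s₀.re 0 + 1 : ℝ) : ℂ) with hp
  have hpre : p.re = max s₀.re 0 + 1 := Complex.ofReal_re _
  have hp0 : 0 < p.re := by linarith [le_max_right s₀.re 0]
  refine hG.eqOn_of_preconnected_of_eventuallyEq hP hconn hp0 ?_ hs
  have hnhds : {w : ℂ | max s₀.re 0 < w.re} ∈ 𝓝 p :=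
    (isOpen_lt continuous_const Complex.continuous_re).mem_nhds (by
      simp only [Set.mem_ofPred_eq]
      linarith)
  filter_upwards [hnhds] with w hw
  exact integral_extension_mul_fourier_of_re_lt hlam hf h₀ ((le_max_left _ _).trans_lt hw)
    ((le_max_right _ _).trans_lt hw) φ hone hzero

theorem norm_partialSum_le_of_bound (hlam : IsFrequency lam) {f : ℂ → ℂ}
    (hf : IsBoundedExtension lam a f) (h₀ : ConvergesAt lam a s₀) {B : ℝ}
    (hB : ∀ z : ℂ, 0 < z.re → ‖f z‖ ≤ B) (hs : 0 < s.re) (φ : 𝓢(ℝ, ℂ)) {N : ℕ}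
    (hone : ∀ n, n < N → φ (lam n) = 1) (hzero : ∀ n, N ≤ n → φ (lam n) = 0) :
    ‖partialSum lam a N s‖ ≤ (∫ t, ‖𝓕 φ t‖) * B := by
  rw [← integral_extension_mul_fourier hlam hf h₀ hs φ hone hzero, mul_comm,
    ← integral_const_mul]
  refine norm_integral_le_of_norm_le ((𝓕 φ : 𝓢(ℝ, ℂ)).integrable.norm.const_mul B)
    (ae_of_all _ fun t => ?_)
  rw [norm_mul]
  exact mul_le_mul_of_nonneg_right (hB _ (by simpa using hs)) (norm_nonneg _)

/-! ### The gap condition and the final estimate. -/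

/-- The logarithm of the inverse gap is controlled by `λ_n ^ d`. -/
theorem exists_log_div_gap_le (hlam : IsFrequency lam) {d : ℝ} (hd : 0 < d)
    (hgrowth : PolynomialGrowth lam d) :
    ∃ C : ℝ, 0 < C ∧ ∀ n, 1 ≤ n →
      1 + Real.log ((lam n + 2) / min 1 (lam (n + 1) - lam n)) ≤ C * lam n ^ d := by
  obtain ⟨l, hl, H⟩ := hgrowth
  -- A single `δ` suffices, since only the order of magnitude of the exponent matters.
  obtain ⟨c, hc, hgap⟩ := H 1 one_pos
  -- `lam 0` may vanish, but `lam 1` cannot: from index `1` on, `λ_n ^ d` is bounded below by `m >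
  -- 0` and can absorb constants.
  have hpos : 0 < lam 1 := (hlam.nonneg 0).trans_lt (hlam.strictMono one_pos)
  set m := lam 1 ^ d with hm
  have hm0 : 0 < m := Real.rpow_pos_of_pos hpos d
  set b := 1 + Real.log 3 + |Real.log c| with hb
  have hlog3 : 0 ≤ Real.log 3 := Real.log_nonneg (by norm_num)
  have hb0 : 0 < b := by positivity
  -- The summands absorb, in order, the constants, `log λ_n ≤ λ_n ^ d / d`, and the exponent of the
  -- gap condition.
  refine ⟨b / m + 1 / d + (l + 1), by positivity, fun n hn => ?_⟩
  have hxm : lam 1 ≤ lam n := hlam.strictMono.monotone hn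
  set x := lam n with hx
  have hx0 : 0 < x := hpos.trans_le hxm
  have hmx : m ≤ x ^ d := Real.rpow_le_rpow hpos.le hxm hd.le
  have hxd : 0 < x ^ d := hm0.trans_le hmx
  have hgap0 : 0 < lam (n + 1) - x := sub_pos.2 (hlam.strictMono n.lt_succ_self)
  have hmin : 0 < min 1 (lam (n + 1) - x) := lt_min one_pos hgap0
  have h1 : Real.log (x + 2) ≤ Real.log 3 + x ^ d / d := by
    rcases le_total x 1 with h | h
    · have : Real.log (x + 2) ≤ Real.log 3 := Real.log_le_log (by linarith) (by linarith)
      have : 0 ≤ x ^ d / d := by positivity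
      linarith
    · have e : Real.log (x + 2) ≤ Real.log (3 * x) := Real.log_le_log (by linarith) (by linarith)
      rw [Real.log_mul (by norm_num) hx0.ne'] at e
      linarith [Real.log_le_rpow_div hx0.le hd]
  have h2 : -(|Real.log c| + (l + 1) * x ^ d) ≤ Real.log (min 1 (lam (n + 1) - x)) := by
    rcases min_choice 1 (lam (n + 1) - x) with h | h
    · rw [h, Real.log_one]
      have : 0 ≤ |Real.log c| + (l + 1) * x ^ d := by positivity
      linarith
    · rw [h]
      have := Real.log_le_log (by positivity) (hgap n)
      rw [Real.log_mul hc.ne' (Real.exp_pos _).ne', Real.log_exp] at this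
      linarith [neg_abs_le (Real.log c)]
  rw [Real.log_div (by linarith) hmin.ne']
  have h3 : b ≤ b / m * x ^ d := by
    rw [div_mul_eq_mul_div, le_div_iff₀ hm0]
    exact mul_le_mul_of_nonneg_left hmx hb0.le
  calc _ ≤ b + x ^ d / d + (l + 1) * x ^ d := by linarith
    _ ≤ b / m * x ^ d + x ^ d / d + (l + 1) * x ^ d := by linarith
    _ = _ := by ring

theorem extension_spec (D : DInftyExt lam) : IsBoundedExtension lam D.1 (extension D) :=
  Classical.choose_spec D.2.2

theorem supNorm_ne_top (D : DInftyExt lam) : supNorm D ≠ ⊤ := by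
  obtain ⟨M, hM⟩ := (extension_spec D).bounded
  refine ne_top_of_le_ne_top ENNReal.ofReal_ne_top (iSup₂_le fun s hs => ?_ : _ ≤ ENNReal.ofReal M)
  rw [← ofReal_norm]
  exact ENNReal.ofReal_le_ofReal (hM s hs)

theorem norm_extension_le (D : DInftyExt lam) {z : ℂ} (hz : 0 < z.re) :
    ‖extension D z‖ ≤ (supNorm D).toReal := by
  rw [← toReal_enorm]
  exact ENNReal.toReal_mono (supNorm_ne_top D)
    (le_iSup₂_of_le (f := fun (s : ℂ) (_ : 0 < s.re) => ‖extension D s‖ₑ) z hz le_rfl)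

theorem exists_halfPlaneSup_partialSum_le (hlam : IsFrequency lam) {d : ℝ} (hd : 0 < d)
    (hgrowth : PolynomialGrowth lam d) :
    ∃ C : ℝ, 0 < C ∧ ∀ N : ℕ, 2 ≤ N → ∀ D : DInftyExt lam,
      halfPlaneSup (partialSum lam D.1 N) ≤ ENNReal.ofReal (C * lam (N - 1) ^ d) * supNorm D := by
  obtain ⟨c, hc, hcut⟩ := exists_cutoff_fourier
  obtain ⟨C, hC, hlog⟩ := exists_log_div_gap_le hlam hd hgrowth
  refine ⟨c * C, by positivity, fun N hN D => iSup₂_le fun s hs => ?_⟩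
  -- With indices starting at `0`, the last frequency in the sum of `N = n + 1` terms is `lam n`.
  obtain ⟨n, rfl⟩ : ∃ n, N = n + 1 := ⟨N - 1, by omega⟩
  rw [Nat.add_sub_cancel]
  have hmono := hlam.strictMono.monotone
  have hgap0 : 0 < lam (n + 1) - lam n := sub_pos.2 (hlam.strictMono n.lt_succ_self)
  -- The cutoff falls to `0` within the gap after `lam n`; the minimum with `1` meets the
  -- requirement `h ≤ 1`.
  obtain ⟨φ, hone, hzero, hφ⟩ := hcut (lam n) (min 1 (lam (n + 1) - lam n)) (hlam.nonneg n)
    (lt_min one_pos hgap0) (min_le_left _ _)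
  obtain ⟨s₀, h₀⟩ := D.2.1
  have key := norm_partialSum_le_of_bound hlam (extension_spec D) h₀
    (fun z hz => norm_extension_le D hz) hs φ (N := n + 1)
    (fun j hj => hone _ (hlam.nonneg j) (hmono (Nat.lt_succ_iff.1 hj)))
    (fun j hj => hzero _ (by
      have := hmono hj
      have := min_le_right 1 (lam (n + 1) - lam n)
      linarith))
  have hbound : ∫ t, ‖𝓕 φ t‖ ≤ c * C * lam n ^ d := by
    rw [mul_assoc]
    exact hφ.trans (mul_le_mul_of_nonneg_left (hlog n (by omega)) hc.le)
  have hnn : 0 ≤ c * C * lam n ^ d :=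
    mul_nonneg (by positivity) (Real.rpow_nonneg (hlam.nonneg n) d)
  rw [← ofReal_norm, ← ENNReal.ofReal_toReal (supNorm_ne_top D), ← ENNReal.ofReal_mul hnn]
  exact ENNReal.ofReal_le_ofReal
    (key.trans (mul_le_mul_of_nonneg_right hbound ENNReal.toReal_nonneg))

end GeneralDirichlet

theorem mainTheorem6 (lam : ℕ → ℝ) (hlam : GeneralDirichlet.IsFrequency lam)
    (d : ℝ) (hd : 0 < d) (hgrowth : GeneralDirichlet.PolynomialGrowth lam d) :
    ∃ C : ℝ, 0 < C ∧ ∀ N : ℕ, 2 ≤ N →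
      GeneralDirichlet.partialSumOpNorm lam N ≤ ENNReal.ofReal (C * lam (N - 1) ^ d) ∧
      ∀ D : GeneralDirichlet.DInftyExt lam,
        GeneralDirichlet.halfPlaneSup (GeneralDirichlet.partialSum lam D.1 N) ≤
          ENNReal.ofReal (C * lam (N - 1) ^ d) * GeneralDirichlet.supNorm D := by
  obtain ⟨C, hC, H⟩ := GeneralDirichlet.exists_halfPlaneSup_partialSum_le hlam hd hgrowth
  refine ⟨C, hC, fun N hN => ⟨iSup₂_le fun D hD => ?_, H N hN⟩⟩
  exact (H N hN D).trans (mul_le_of_le_one_right' hD)
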